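/- **Setting.** There are $K$ arms. Let $\mathcal D$ be a set of probability distributions on $\mathbb R$ with finite expectation. A bandit instance $\underline\nu=(\nu_a)_{a\in[K]}\in\mathcal D$ consists of a reward distribution $\nu_a\in\mathcal D$ of expectation $\mu_a$ for each arm $a\in[K]=\{1,\dots,K\}$. Put $\mu^*=\max_{a}\mu_a$ and let $\mathcal A_*(\underline\nu)=\{a:\mu_a=\mu^*\}$ be the set of optimal arms. Let $(U_t)_{t\ge 0}$ be i.i.d. uniform on $[0,1]$ (internal randomization). A bandit strategy is a sequence of measurable maps that send the history $I_t=(U_0,a_1,q_1,R_1q_1,U_1,\dots,a_t,q_t,R_tq_t,U_t)$ to the next arm $a_{t+1}\in[K]$ and the next query decision $q_{t+1}\in\{0,1\}$; given these, a reward $R_{t+1}\sim\nu_{a_{t+1}}$ is drawn independently of the past, and only $R_{t+1}q_{t+1}$ is observed. $\mathbb E_{\underline\nu}$ denotes the expectation under this interaction. Let $$N_T(a)=\sum_{s=1}^T\mathbf 1\{a_s=a\},\qquad N^q_T(a)=\sum_{s=1}^T\mathbf 1\{a_s=a,\ q_s=1\}.$$ Define $$\mathcal K_{\inf}^+(\nu,\mu,\mathcal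 D)=\inf\{\mathrm{KL}(\nu,\nu'):\nu'\in\mathcal D,\ \mathbb E[\nu']>\mu\}\in[0,\infty],$$ with $\inf\emptyset=+\infty$. A strategy is *better-than-uniform* on $\mathcal D$ if for every instance $\underline\nu\in\mathcal D$ and every $T\ge1$, $$\sum_{a\in\mathcal A_*(\underline\nu)}\mathbb E_{\underline\nu}[N_T(a)]\ \ge\ \frac{|\mathcal A_*(\underline\nu)|}{K}\,T.$$ **Proposition.** For every strategy that is better-than-uniform on $\mathcal D$, every bandit instance $\underline\nu\in\mathcal D$, every suboptimal arm $a\notin\mathcal A_*(\underline\nu)$ and every $T\ge1$, $$\mathbb E_{\underline\nu}[N_T(a)]\ \ge\ \frac TK\left(1-\sqrt{2\min\{K\,\mathbb E_{\underline\nu}[N^q_T(a)],\,T\}\;\mathcal K_{\inf}^+(\nu_a,\mu^*,\mathcal D)}\right),$$ where the right-hand side is defined to be $0$ if $\mathcal K_{\inf}^+(\nu_a,\mu^*,\mathcal D)=\infty$. In particular, if $\mathcal K_{\inf}^+(\nu_a,\mu^*,\mathcal D)<\infty$ and $\mathbb E_{\underline\nu}[N^q_T(a)]\le \frac{1}{8K\,\mathcal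 K_{\inf}^+(\nu_a,\mu^*,\mathcal D)}$ (with $1/0=+\infty$), then $\mathbb E_{\underline\nu}[N_T(a)]\ge \frac{T}{2K}$. -/

import Mathlib

open MeasureTheory ProbabilityTheory InformationTheory Finset
open scoped ENNReal unitInterval

noncomputable section

namespace QueryBandit

/-- What is appended to the history in one round: the played arm `a_t` and the query decision `q_t`,
the observation `R_t * q_t`, and the fresh internal randomization `U_t`. -/
abbrev Round (K : ℕ) : Type := ((Fin K × Bool) × ℝ) × I

/-- The `t`-th entry of an interaction: `U_0` for `t = 0`, and the record of round `t` for
`t ≥ 1`. -/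
def Entry (K : ℕ) : ℕ → Type
  | 0 => I
  | _ + 1 => Round K

instance instMeasurableSpaceEntry (K : ℕ) : (t : ℕ) → MeasurableSpace (Entry K t)
  | 0 => inferInstanceAs (MeasurableSpace I)
  | _ + 1 => inferInstanceAs (MeasurableSpace (Round K))

/-- The history `I_t = (U_0, a_1, q_1, R_1 q_1, U_1, …, a_t, q_t, R_t q_t, U_t)`. -/
abbrev History (K t : ℕ) : Type := (i : Finset.Iic t) → Entry K i

/-- A whole interaction `(U_0, a_1, q_1, R_1 q_1, U_1, a_2, …)`. -/
abbrev Interaction (K : ℕ) : Type := (t : ℕ) → Entry K t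

/-- A bandit strategy: it maps (measurably) the history `I_t` to the next arm `a_{t+1}` and the next
query decision `q_{t+1}`. -/
structure Strategy (K : ℕ) where
  next : (t : ℕ) → History K t → Fin K × Bool
  measurable_next : ∀ t, Measurable (next t)

/-- A bandit instance: a reward distribution for each arm. -/
abbrev Instance (K : ℕ) : Type := Fin K → ProbabilityMeasure ℝ

/-- The expectation of a reward distribution. -/
def mean (ν : ProbabilityMeasure ℝ) : ℝ := ∫ x, x ∂(ν : Measure ℝ)

/-- The optimal reward `μ*` of an instance. -/
def optReward {K : ℕ} (ν : Instance K) : ℝ := ⨆ a, mean (ν a)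

/-- The set of optimal arms of an instance. -/
def optArms {K : ℕ} (ν : Instance K) : Finset (Fin K) := {a | mean (ν a) = optReward ν}

/-- The law of the observation `R * q`, where the reward `R` has law `ν_a`. -/
def obsLaw {K : ℕ} (ν : Instance K) (aq : Fin K × Bool) : Measure ℝ :=
  (ν aq.1 : Measure ℝ).map (fun r => if aq.2 then r else 0)

instance instIsProbabilityMeasureObsLaw {K : ℕ} (ν : Instance K) (aq : Fin K × Bool) :
    IsProbabilityMeasure (obsLaw ν aq) := by
  unfold obsLaw
  refine Measure.isProbabilityMeasure_map (Measurable.aemeasurable ?_)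
  cases aq.2 <;> (simp; try fun_prop)

/-- The law of the record of a round, given the arm and the query decision taken in it: the
observation and the fresh uniform variable are independent. -/
def roundKernel {K : ℕ} (ν : Instance K) : Kernel (Fin K × Bool) (Round K) where
  toFun aq := ((Measure.dirac aq).prod (obsLaw ν aq)).prod (volume : Measure I)
  measurable' := measurable_of_countable _

instance instIsMarkovKernelRoundKernel {K : ℕ} (ν : Instance K) :
    IsMarkovKernel (roundKernel ν) where
  isProbabilityMeasure aq :=
    inferInstanceAs
      (IsProbabilityMeasure (((Measure.dirac aq).prod (obsLaw ν aq)).prod (volume : Measure I)))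

/-- The conditional law of the record of round `t + 1` given the history `I_t`. -/
def stepKernel {K : ℕ} (π : Strategy K) (ν : Instance K) (t : ℕ) :
    Kernel (History K t) (Entry K (t + 1)) :=
  (roundKernel ν).comap (π.next t) (π.measurable_next t)

instance instIsMarkovKernelStepKernel {K : ℕ} (π : Strategy K) (ν : Instance K) (t : ℕ) :
    IsMarkovKernel (stepKernel π ν t) :=
  inferInstanceAs (IsMarkovKernel ((roundKernel ν).comap (π.next t) (π.measurable_next t)))

/-- The law of `U_0`. -/
def seedLaw (K : ℕ) : Measure (Entry K 0) := (volume : Measure I)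

instance instIsProbabilityMeasureSeedLaw (K : ℕ) : IsProbabilityMeasure (seedLaw K) :=
  inferInstanceAs (IsProbabilityMeasure (volume : Measure I))

/-- The law of the interaction of the strategy `π` with the instance `ν`. -/
def law {K : ℕ} (π : Strategy K) (ν : Instance K) : Measure (Interaction K) :=
  Kernel.trajMeasure (seedLaw K) (stepKernel π ν)

/-- The arm `a_{s+1}` played in round `s + 1`. -/
def arm {K : ℕ} (s : ℕ) (ω : Interaction K) : Fin K :=
  let r : Round K := ω (s + 1)
  r.1.1.1

/-- The query decision `q_{s+1}` taken in round `s + 1`. -/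
def query {K : ℕ} (s : ℕ) (ω : Interaction K) : Bool :=
  let r : Round K := ω (s + 1)
  r.1.1.2

/-- The number of plays of arm `a` in rounds `1, …, T`. -/
def plays {K : ℕ} (T : ℕ) (a : Fin K) (ω : Interaction K) : ℝ :=
  ∑ s ∈ range T, if arm s ω = a then 1 else 0

/-- The number of queries of arm `a` in rounds `1, …, T`. -/
def queries {K : ℕ} (T : ℕ) (a : Fin K) (ω : Interaction K) : ℝ :=
  ∑ s ∈ range T, if arm s ω = a ∧ query s ω = true then 1 else 0

/-- The expected number of plays of arm `a` in rounds `1, …, T`. -/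
def expPlays {K : ℕ} (π : Strategy K) (ν : Instance K) (T : ℕ) (a : Fin K) : ℝ :=
  ∫ ω, plays T a ω ∂(law π ν)

/-- The expected number of queries of arm `a` in rounds `1, …, T`. -/
def expQueries {K : ℕ} (π : Strategy K) (ν : Instance K) (T : ℕ) (a : Fin K) : ℝ :=
  ∫ ω, queries T a ω ∂(law π ν)

/-- A strategy is better than uniform on `D` if on every instance with reward distributions in `D`,
the optimal arms are together played at least as often, in expectation, as under uniform play. -/
def BetterThanUniform {K : ℕ} (π : Strategy K) (D : Set (ProbabilityMeasure ℝ)) : Prop :=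
  ∀ ν : Instance K, (∀ k, ν k ∈ D) → ∀ T : ℕ, 1 ≤ T →
    ((optArms ν).card : ℝ) / K * T ≤ ∑ a ∈ optArms ν, expPlays π ν T a

/-- The infimum of `KL(ν, ν')` over `ν' ∈ D` with expectation larger than `μ`
(`∞` if there are none). -/
def KinfPlus (ν : ProbabilityMeasure ℝ) (μ : ℝ) (D : Set (ProbabilityMeasure ℝ)) : ℝ≥0∞ :=
  ⨅ ν' ∈ {ν' | ν' ∈ D ∧ μ < mean ν'}, klDiv (ν : Measure ℝ) (ν' : Measure ℝ)

end QueryBandit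

end

namespace QueryBandit

/-! ### Kullback-Leibler divergence -/

section KL

variable {α β : Type*} {mα : MeasurableSpace α} {mβ : MeasurableSpace β}

/-! The proof is a change of measure in the law of arm `a` alone. Replace `ν a` by some `ρ ∈ D` with
mean above `μ*`: then `a` is the unique optimal arm, so a better-than-uniform strategy plays it at
least `T / K` times in expectation. The two interactions differ only when `a` is queried, so their
histories have divergence at most `E[N^q_T(a)] * KL(ν_a, ρ)` (`klDiv_historyLaw_le`). A local
Pinsker inequality (`sq_sub_integral_le_klDiv`) for `N_T(a) / T` at the level `q = 1 / K` compares
the two expected play counts. Its factor `q` yields `K * E[N^q_T(a)]` under the root, where the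
usual Pinsker inequality would give order `K ^ 2`. Taking the infimum over `ρ` gives `KinfPlus`. -/

lemma mul_le_klFun_add_exp_sub_one {r : ℝ} (hr : 0 ≤ r) (y : ℝ) :
    r * y ≤ klFun r + (Real.exp y - 1) := by
  rcases hr.eq_or_lt with rfl | hr
  · simp [klFun_zero, (Real.exp_pos y).le]
  -- Young's inequality: `klFun` and `exp - 1` are convex conjugates.
  · have h1 := Real.log_le_sub_one_of_pos (div_pos (Real.exp_pos y) hr)
    rw [Real.log_div (Real.exp_pos y).ne' hr.ne', Real.log_exp] at h1
    have h2 := mul_le_mul_of_nonneg_left h1 hr.le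
    have h3 : r * (Real.exp y / r - 1) = Real.exp y - r := by field_simp
    rw [klFun_apply]
    linarith

/-- The variational lower bound on the Kullback-Leibler divergence. -/
lemma integral_le_toReal_klDiv_add {P Q : Measure α} [IsProbabilityMeasure P]
    [IsProbabilityMeasure Q] (hPQ : klDiv P Q ≠ ∞) {f : α → ℝ} (hfP : Integrable f P)
    (hfQ : Integrable (fun x => Real.exp (f x)) Q) :
    ∫ x, f x ∂P ≤ (klDiv P Q).toReal + (∫ x, Real.exp (f x) ∂Q - 1) := by
  obtain ⟨hac, hint⟩ := klDiv_ne_top_iff.1 hPQ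
  have h1 := (integrable_klFun_rnDeriv_iff hac).2 hint
  have h2 : Integrable (fun x => Real.exp (f x) - 1) Q := hfQ.sub (integrable_const _)
  have h3 : ∫ x, (Real.exp (f x) - 1) ∂Q = ∫ x, Real.exp (f x) ∂Q - 1 := by
    rw [integral_sub hfQ (integrable_const _)]; simp
  rw [toReal_klDiv_eq_integral_klFun hac, ← h3, ← integral_add h1 h2, ← integral_rnDeriv_smul hac]
  refine integral_mono ((integrable_rnDeriv_smul_iff hac).2 hfP) (h1.add h2) fun x => ?_
  exact mul_le_klFun_add_exp_sub_one ENNReal.toReal_nonneg _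

/-- Follows from `1 + x + x²/2 ≤ exp x`, as `(1 - x + x²/2) * (1 + x + x²/2) = 1 + x⁴/4 ≥ 1`. -/
lemma exp_neg_le_quadratic {x : ℝ} (hx : 0 ≤ x) : Real.exp (-x) ≤ 1 - x + x ^ 2 / 2 := by
  have h := Real.quadratic_le_exp_of_nonneg hx
  rw [Real.exp_neg]
  refine inv_le_of_inv_le₀ (by nlinarith [sq_nonneg (x - 1)]) ?_
  refine le_trans ?_ h
  rw [inv_le_iff_one_le_mul₀ (by nlinarith [sq_nonneg (x - 1)])]
  nlinarith [sq_nonneg (x ^ 2)]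

/-- A local form of Pinsker's inequality for the expectations of a `[0, 1]`-valued variable. -/
lemma sq_sub_integral_le_klDiv {P Q : Measure α} [IsProbabilityMeasure P]
    [IsProbabilityMeasure Q] (hPQ : klDiv P Q ≠ ∞) {Z : α → ℝ} (hZ : Measurable Z)
    (hZ0 : ∀ x, 0 ≤ Z x) (hZ1 : ∀ x, Z x ≤ 1) {q : ℝ} (hq : 0 < q)
    (hP : ∫ x, Z x ∂P ≤ q) (hQ : q ≤ ∫ x, Z x ∂Q) :
    (q - ∫ x, Z x ∂P) ^ 2 ≤ 2 * q * (klDiv P Q).toReal := by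
  have hZint (R : Measure α) [IsProbabilityMeasure R] : Integrable Z R :=
    Integrable.of_bound hZ.aestronglyMeasurable 1 (.of_forall fun x => by
      rw [Real.norm_eq_abs, abs_of_nonneg (hZ0 x)]; exact hZ1 x)
  set p := ∫ x, Z x ∂P with hp
  have hp0 : 0 ≤ p := integral_nonneg hZ0
  -- This `l` maximizes `l * (q - p) - l² * q / 2`, the lower bound on the divergence obtained from
  -- the test function `-l * Z`.
  obtain ⟨l, hl⟩ : ∃ l, l = (q - p) / q := ⟨_, rfl⟩
  have hlq : l * q = q - p := by rw [hl]; field_simp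
  have hl0 : 0 ≤ l := by rw [hl]; exact div_nonneg (by linarith) hq.le
  have hl1 : l ≤ 1 := by rw [hl, div_le_one hq]; linarith
  have hexp : Integrable (fun x => Real.exp (-(l * Z x))) Q :=
    Integrable.of_bound (by fun_prop) 1 (.of_forall fun x => by
      rw [Real.norm_eq_abs, abs_of_pos (Real.exp_pos _), Real.exp_le_one_iff]
      have := mul_nonneg hl0 (hZ0 x)
      linarith)
  have h := integral_le_toReal_klDiv_add hPQ (f := fun x => -(l * Z x))
    ((hZint P).const_mul l).neg hexp
  have hquad : ∫ x, Real.exp (-(l * Z x)) ∂Q ≤ ∫ x, (1 - (l - l ^ 2 / 2) * Z x) ∂Q := by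
    refine integral_mono hexp ((integrable_const _).sub ((hZint Q).const_mul _)) fun x => ?_
    refine (exp_neg_le_quadratic (mul_nonneg hl0 (hZ0 x))).trans ?_
    -- This makes the second-order term linear in `Z`, so that only the mean of `Z` enters; hence
    -- the factor `q` in the conclusion.
    have : Z x ^ 2 ≤ Z x := by nlinarith [hZ0 x, hZ1 x]
    nlinarith [mul_le_mul_of_nonneg_left this (sq_nonneg l)]
  rw [integral_sub (integrable_const _) ((hZint Q).const_mul _), integral_const_mul] at hquad
  rw [integral_neg, integral_const_mul, ← hp] at h
  simp only [integral_const, probReal_univ, smul_eq_mul, mul_one] at hquad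
  have hcoef : 0 ≤ l - l ^ 2 / 2 := by nlinarith
  have h5 := mul_le_mul_of_nonneg_left hQ hcoef
  have h6 : l * (q - p) - l ^ 2 * q / 2 ≤ (klDiv P Q).toReal := by nlinarith
  have h7 := mul_le_mul_of_nonneg_left h6 (by positivity : 0 ≤ 2 * q)
  have h8 : 2 * q * (l * (q - p) - l ^ 2 * q / 2) = 2 * (l * q) * (q - p) - (l * q) ^ 2 := by ring
  rw [h8, hlq] at h7
  nlinarith

/-- The conditional Kullback-Leibler divergence is the integral of the divergences. -/
lemma klDiv_compProd_right [MeasurableSpace.CountableOrCountablyGenerated α β] (μ : Measure α)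
    [IsFiniteMeasure μ] (κ η : Kernel α β) [IsFiniteKernel κ] [IsFiniteKernel η]
    (hκη : ∀ x, κ x ≪ η x) :
    klDiv (μ ⊗ₘ κ) (μ ⊗ₘ η) = ∫⁻ x, klDiv (κ x) (η x) ∂μ := by
  -- The kernel derivative is jointly measurable, so it serves as density both on the product and on
  -- each fibre.
  have hκ : η.withDensity (κ.rnDeriv η) = κ := by
    ext1 x; exact Kernel.withDensity_rnDeriv_eq (hκη x)
  have hmeas : Measurable fun p : α × β => κ.rnDeriv η p.1 p.2 := Kernel.measurable_rnDeriv κ η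
  have hκ' : IsSFiniteKernel (η.withDensity (κ.rnDeriv η)) := by rw [hκ]; infer_instance
  have hdens : μ ⊗ₘ κ = (μ ⊗ₘ η).withDensity fun p => κ.rnDeriv η p.1 p.2 := by
    conv_lhs => rw [← hκ]
    exact Measure.compProd_withDensity hmeas
  have hac : μ ⊗ₘ κ ≪ μ ⊗ₘ η := Measure.AbsolutelyContinuous.compProd_right (.of_forall hκη)
  have hrn : (μ ⊗ₘ κ).rnDeriv (μ ⊗ₘ η) =ᵐ[μ ⊗ₘ η] fun p => κ.rnDeriv η p.1 p.2 := by
    rw [hdens]; exact Measure.rnDeriv_withDensity _ hmeas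
  have hcongr : ∫⁻ p, ENNReal.ofReal (klFun ((μ ⊗ₘ κ).rnDeriv (μ ⊗ₘ η) p).toReal) ∂(μ ⊗ₘ η) =
      ∫⁻ p, ENNReal.ofReal (klFun (κ.rnDeriv η p.1 p.2).toReal) ∂(μ ⊗ₘ η) :=
    lintegral_congr_ae (hrn.fun_comp fun r => ENNReal.ofReal (klFun r.toReal))
  rw [klDiv_eq_lintegral_klFun_of_ac hac, hcongr, Measure.lintegral_compProd (by fun_prop)]
  refine lintegral_congr fun x => ?_
  rw [klDiv_eq_lintegral_klFun_of_ac (hκη x)]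
  exact lintegral_congr_ae
    ((Kernel.rnDeriv_eq_rnDeriv_measure (κ := κ) (η := η) (a := x)).fun_comp
      fun r => ENNReal.ofReal (klFun r.toReal))

end KL

variable {K : ℕ}

/-! ### One round -/

lemma roundKernel_eq_map (ν : Instance K) (aq : Fin K × Bool) :
    roundKernel ν aq =
      ((obsLaw ν aq).prod (volume : Measure I)).map (fun x : ℝ × I => ((aq, x.1), x.2)) := by
  change ((Measure.dirac aq).prod (obsLaw ν aq)).prod (volume : Measure I) = _
  rw [Measure.dirac_prod]
  have h := Measure.map_prod_map (obsLaw ν aq) (volume : Measure I)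
    (f := Prod.mk aq) (g := id) (by fun_prop) measurable_id
  rw [Measure.map_id] at h
  exact h

lemma roundKernel_apply_eq_ite (ν : Instance K) (aq bq : Fin K × Bool) :
    roundKernel ν aq {r | r.1.1 = bq} = if aq = bq then 1 else 0 := by
  have hs : MeasurableSet {r : Round K | r.1.1 = bq} :=
    (measurable_fst.comp measurable_fst) (measurableSet_singleton bq)
  rw [roundKernel_eq_map, Measure.map_apply (by fun_prop) hs]
  by_cases h : aq = bq <;> simp [h]

lemma obsLaw_true (ν : Instance K) (a : Fin K) : obsLaw ν (a, true) = (ν a : Measure ℝ) := by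
  simp [obsLaw]

lemma obsLaw_false (ν : Instance K) (a : Fin K) : obsLaw ν (a, false) = Measure.dirac 0 := by
  simp [obsLaw]

lemma obsLaw_eq_of_ne {ν ν' : Instance K} {a : Fin K} (hν : ∀ b ≠ a, ν b = ν' b)
    {aq : Fin K × Bool} (haq : aq ≠ (a, true)) : obsLaw ν aq = obsLaw ν' aq := by
  obtain ⟨b, q⟩ := aq
  cases q
  · rw [obsLaw_false, obsLaw_false]
  · rw [obsLaw_true, obsLaw_true, hν b (by rintro rfl; exact haq rfl)]

/-- An unqueried round shows `0` under both instances, and the other arms have equal laws. When `a`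
is queried, the common uniform factor adds no divergence. -/
lemma klDiv_roundKernel_le {ν ν' : Instance K} {a : Fin K} (hν : ∀ b ≠ a, ν b = ν' b)
    (aq : Fin K × Bool) :
    klDiv (roundKernel ν aq) (roundKernel ν' aq) ≤
      klDiv (ν a : Measure ℝ) (ν' a) * roundKernel ν aq {r | r.1.1 = (a, true)} := by
  rw [roundKernel_apply_eq_ite]
  split_ifs with h
  · subst h
    rw [roundKernel_eq_map, roundKernel_eq_map, mul_one]
    refine (klDiv_map_le _ _ (by fun_prop)).trans ?_
    rw [← Measure.compProd_const, ← Measure.compProd_const, klDiv_compProd_left, obsLaw_true,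
      obsLaw_true]
  · rw [roundKernel_eq_map, roundKernel_eq_map, obsLaw_eq_of_ne hν h, klDiv_self, mul_zero]

/-! ### The law of the history -/

/-- The law of the history `I_t`. -/
noncomputable def historyLaw (π : Strategy K) (ν : Instance K) (t : ℕ) : Measure (History K t) :=
  (law π ν).map (Preorder.frestrictLe t)

instance instIsProbabilityMeasureLaw (π : Strategy K) (ν : Instance K) :
    IsProbabilityMeasure (law π ν) :=
  inferInstanceAs (IsProbabilityMeasure (Kernel.trajMeasure (seedLaw K) (stepKernel π ν)))

instance instIsProbabilityMeasureHistoryLaw (π : Strategy K) (ν : Instance K) (t : ℕ) :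
    IsProbabilityMeasure (historyLaw π ν t) :=
  Measure.isProbabilityMeasure_map (by fun_prop)

lemma historyLaw_compProd_stepKernel (π : Strategy K) (ν : Instance K) (t : ℕ) :
    historyLaw π ν t ⊗ₘ stepKernel π ν t =
      (law π ν).map (fun ω => (Preorder.frestrictLe t ω, ω (t + 1))) :=
  Kernel.map_frestrictLe_trajMeasure_compProd_eq_map_trajMeasure

/-- The right-hand side does not involve `ν`: the divergence of histories starts at zero. -/
lemma historyLaw_zero (π : Strategy K) (ν : Instance K) :
    historyLaw π ν 0 = (seedLaw K).map (MeasurableEquiv.piUnique _).symm := by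
  rw [historyLaw, law, Kernel.trajMeasure, Measure.map_comp _ _ (by fun_prop),
    Kernel.traj_map_frestrictLe, Kernel.partialTraj_self, Measure.id_comp]

lemma exists_measurable_append (t : ℕ) :
    ∃ g : History K t × Entry K (t + 1) → History K (t + 1), Measurable g ∧
      ∀ ω : Interaction K, g (Preorder.frestrictLe t ω, ω (t + 1)) =
        Preorder.frestrictLe (t + 1) ω := by
  refine ⟨fun p => IicProdIoc t (t + 1) (p.1, MeasurableEquiv.piSingleton t p.2), by fun_prop,
    fun ω => ?_⟩
  funext ⟨i, hi⟩
  simp only [IicProdIoc]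
  split_ifs with h
  · rfl
  · obtain rfl : i = t + 1 := le_antisymm (mem_Iic.1 hi) (not_le.1 h)
    rfl

/-- Chain rule for one more round; gluing the new record onto the history cannot increase the
divergence. -/
lemma klDiv_historyLaw_succ_le (π : Strategy K) (ν ν' : Instance K) (t : ℕ) :
    klDiv (historyLaw π ν (t + 1)) (historyLaw π ν' (t + 1)) ≤
      klDiv (historyLaw π ν t) (historyLaw π ν' t) +
        klDiv (historyLaw π ν t ⊗ₘ stepKernel π ν t) (historyLaw π ν t ⊗ₘ stepKernel π ν' t) := by
  obtain ⟨g, hg, hgω⟩ := exists_measurable_append (K := K) t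
  have hmap (ρ : Instance K) : historyLaw π ρ (t + 1) =
      (historyLaw π ρ t ⊗ₘ stepKernel π ρ t).map g := by
    rw [historyLaw_compProd_stepKernel, Measure.map_map hg (by fun_prop)]
    exact congrArg (fun f => Measure.map f (law π ρ)) (funext fun ω => (hgω ω).symm)
  rw [hmap, hmap, ← klDiv_compProd_eq_add]
  exact klDiv_map_le _ _ hg

lemma lintegral_roundKernel_next (π : Strategy K) (ν : Instance K) (t : ℕ) (bq : Fin K × Bool) :
    ∫⁻ h, roundKernel ν (π.next t h) {r | r.1.1 = bq} ∂(historyLaw π ν t) =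
      law π ν {ω | arm t ω = bq.1 ∧ query t ω = bq.2} := by
  have hs : MeasurableSet {r : Round K | r.1.1 = bq} :=
    (measurable_fst.comp measurable_fst) (measurableSet_singleton bq)
  have hs' : MeasurableSet (Prod.snd ⁻¹' {r : Round K | r.1.1 = bq} :
      Set (History K t × Entry K (t + 1))) := measurable_snd hs
  have h := congrArg (fun m => m (Prod.snd ⁻¹' {r : Round K | r.1.1 = bq}))
    (historyLaw_compProd_stepKernel π ν t)
  rw [Measure.compProd_apply hs', Measure.map_apply (by fun_prop) hs'] at h
  refine h.trans (congrArg (law π ν) ?_)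
  ext ω
  exact Prod.ext_iff

lemma klDiv_step_le (π : Strategy K) {ν ν' : Instance K} {a : Fin K}
    (hν : ∀ b ≠ a, ν b = ν' b) (hfin : klDiv (ν a : Measure ℝ) (ν' a) ≠ ∞) (t : ℕ) :
    klDiv (historyLaw π ν t ⊗ₘ stepKernel π ν t) (historyLaw π ν t ⊗ₘ stepKernel π ν' t) ≤
      klDiv (ν a : Measure ℝ) (ν' a) * law π ν {ω | arm t ω = a ∧ query t ω = true} := by
  -- Finiteness supplies the absolute continuity required by `klDiv_compProd_right`.
  have hfin' (aq : Fin K × Bool) : klDiv (roundKernel ν aq) (roundKernel ν' aq) ≠ ∞ :=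
    ne_top_of_le_ne_top (ENNReal.mul_ne_top hfin (measure_ne_top _ _)) (klDiv_roundKernel_le hν aq)
  have h := klDiv_compProd_right (historyLaw π ν t)
    ((roundKernel ν).comap (π.next t) (π.measurable_next t))
    ((roundKernel ν').comap (π.next t) (π.measurable_next t))
    fun x => (klDiv_ne_top_iff.1 (hfin' _)).1
  refine (le_of_eq h).trans ?_
  rw [← lintegral_roundKernel_next π ν t (a, true), ← lintegral_const_mul' _ _ hfin]
  exact lintegral_mono fun x => klDiv_roundKernel_le hν _

/-! ### Plays and queries -/

lemma measurable_arm (t : ℕ) : Measurable (arm t : Interaction K → Fin K) := by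
  have h : Measurable (fun ω : Interaction K => (ω (t + 1) : Round K)) := measurable_pi_apply _
  exact (measurable_fst.comp (measurable_fst.comp measurable_fst)).comp h

lemma measurable_query (t : ℕ) : Measurable (query t : Interaction K → Bool) := by
  have h : Measurable (fun ω : Interaction K => (ω (t + 1) : Round K)) := measurable_pi_apply _
  exact (measurable_snd.comp (measurable_fst.comp measurable_fst)).comp h

lemma measurableSet_query (t : ℕ) (a : Fin K) :
    MeasurableSet {ω : Interaction K | arm t ω = a ∧ query t ω = true} :=
  (measurable_arm t (measurableSet_singleton a)).inter
    (measurable_query t (measurableSet_singleton true))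

lemma measurable_plays (T : ℕ) (a : Fin K) : Measurable (plays T a) :=
  Finset.measurable_fun_sum _ fun t _ =>
    Measurable.ite (measurable_arm t (measurableSet_singleton a)) measurable_const measurable_const

lemma measurable_queries (T : ℕ) (a : Fin K) : Measurable (queries T a) :=
  Finset.measurable_fun_sum _ fun t _ =>
    Measurable.ite (measurableSet_query t a) measurable_const measurable_const

lemma plays_nonneg (T : ℕ) (a : Fin K) (ω : Interaction K) : 0 ≤ plays T a ω :=
  Finset.sum_nonneg fun _ _ => by split_ifs <;> norm_num

lemma queries_nonneg (T : ℕ) (a : Fin K) (ω : Interaction K) : 0 ≤ queries T a ω :=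
  Finset.sum_nonneg fun _ _ => by split_ifs <;> norm_num

lemma plays_le (T : ℕ) (a : Fin K) (ω : Interaction K) : plays T a ω ≤ T := by
  refine (Finset.sum_le_card_nsmul (range T) _ 1 fun _ _ => by split_ifs <;> norm_num).trans ?_
  simp

lemma queries_le_plays (T : ℕ) (a : Fin K) (ω : Interaction K) : queries T a ω ≤ plays T a ω :=
  Finset.sum_le_sum fun _ _ => by split_ifs <;> simp_all

lemma integrable_plays (π : Strategy K) (ν : Instance K) (T : ℕ) (a : Fin K) :
    Integrable (plays T a) (law π ν) :=
  Integrable.of_bound (measurable_plays T a).aestronglyMeasurable T (.of_forall fun ω => by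
    rw [Real.norm_eq_abs, abs_of_nonneg (plays_nonneg T a ω)]; exact plays_le T a ω)

lemma integrable_queries (π : Strategy K) (ν : Instance K) (T : ℕ) (a : Fin K) :
    Integrable (queries T a) (law π ν) :=
  (integrable_plays π ν T a).mono' (measurable_queries T a).aestronglyMeasurable
    (.of_forall fun ω => by
      rw [Real.norm_eq_abs, abs_of_nonneg (queries_nonneg T a ω)]; exact queries_le_plays T a ω)

lemma expPlays_nonneg (π : Strategy K) (ν : Instance K) (T : ℕ) (a : Fin K) :
    0 ≤ expPlays π ν T a := integral_nonneg (plays_nonneg T a)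

lemma expQueries_nonneg (π : Strategy K) (ν : Instance K) (T : ℕ) (a : Fin K) :
    0 ≤ expQueries π ν T a := integral_nonneg (queries_nonneg T a)

lemma expQueries_le_expPlays (π : Strategy K) (ν : Instance K) (T : ℕ) (a : Fin K) :
    expQueries π ν T a ≤ expPlays π ν T a :=
  integral_mono (integrable_queries π ν T a) (integrable_plays π ν T a) (queries_le_plays T a)

lemma ofReal_expQueries (π : Strategy K) (ν : Instance K) (T : ℕ) (a : Fin K) :
    ENNReal.ofReal (expQueries π ν T a) =
      ∑ t ∈ range T, law π ν {ω | arm t ω = a ∧ query t ω = true} := by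
  rw [expQueries, ofReal_integral_eq_lintegral_ofReal (integrable_queries π ν T a)
    (.of_forall (queries_nonneg T a))]
  have h (ω : Interaction K) : ENNReal.ofReal (queries T a ω) = ∑ t ∈ range T,
      Set.indicator {ω | arm t ω = a ∧ query t ω = true} (fun _ => (1 : ℝ≥0∞)) ω := by
    rw [queries, ENNReal.ofReal_sum_of_nonneg fun _ _ => by split_ifs <;> norm_num]
    refine Finset.sum_congr rfl fun t _ => ?_
    by_cases h : arm t ω = a ∧ query t ω = true <;> simp [h]
  simp_rw [h]
  rw [lintegral_finsetSum _ fun t _ => measurable_const.indicator (measurableSet_query t a)]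
  refine Finset.sum_congr rfl fun t _ => ?_
  rw [lintegral_indicator (measurableSet_query t a)]
  simp

/-- The divergence decomposition: only queries of the arm `a` are informative. -/
lemma klDiv_historyLaw_le (π : Strategy K) {ν ν' : Instance K} {a : Fin K}
    (hν : ∀ b ≠ a, ν b = ν' b) (hfin : klDiv (ν a : Measure ℝ) (ν' a) ≠ ∞) (T : ℕ) :
    klDiv (historyLaw π ν T) (historyLaw π ν' T) ≤
      klDiv (ν a : Measure ℝ) (ν' a) * ENNReal.ofReal (expQueries π ν T a) := by
  rw [ofReal_expQueries]
  induction T with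
  | zero => rw [(historyLaw_zero π ν').trans (historyLaw_zero π ν).symm, klDiv_self]; exact zero_le
  | succ t ih =>
    rw [Finset.sum_range_succ, mul_add]
    exact (klDiv_historyLaw_succ_le π ν ν' t).trans (add_le_add ih (klDiv_step_le π hν hfin t))

/-- The number of plays of `a` in rounds `1, …, T`, as a function of the history `I_T`. -/
lemma exists_measurable_plays_eq (T : ℕ) (a : Fin K) :
    ∃ F : History K T → ℝ, Measurable F ∧ (∀ h, 0 ≤ F h) ∧ (∀ h, F h ≤ T) ∧
      ∀ ω : Interaction K, F (Preorder.frestrictLe T ω) = plays T a ω := by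
  let A : (s : Fin T) → History K T → Fin K := fun s h =>
    (h ⟨s + 1, mem_Iic.2 s.2⟩ : Round K).1.1.1
  have hA (s : Fin T) : Measurable (A s) := by
    have h : Measurable (fun h : History K T => (h ⟨s + 1, mem_Iic.2 s.2⟩ : Round K)) :=
      measurable_pi_apply _
    exact (measurable_fst.comp (measurable_fst.comp measurable_fst)).comp h
  refine ⟨fun h => ∑ s, if A s h = a then 1 else 0, ?_, fun h => ?_, fun h => ?_, fun ω => ?_⟩
  · exact Finset.measurable_fun_sum _ fun s _ =>
      Measurable.ite (hA s (measurableSet_singleton a)) measurable_const measurable_const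
  · exact Finset.sum_nonneg fun _ _ => by split_ifs <;> norm_num
  · refine (Finset.sum_le_card_nsmul univ _ 1 fun _ _ => by split_ifs <;> norm_num).trans ?_
    simp
  · rw [plays, ← Fin.sum_univ_eq_sum_range (fun s => if arm s ω = a then (1 : ℝ) else 0)]
    rfl

/-! ### The lower bound -/

lemma sq_sub_expPlays_le (π : Strategy K) {ν ν' : Instance K} {a : Fin K}
    (hν : ∀ b ≠ a, ν b = ν' b) (hfin : klDiv (ν a : Measure ℝ) (ν' a) ≠ ∞) {T : ℕ} (hT : 1 ≤ T)
    {q : ℝ} (hq : 0 < q) (hP : expPlays π ν T a ≤ q * T) (hQ : q * T ≤ expPlays π ν' T a) :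
    (q - expPlays π ν T a / T) ^ 2 ≤
      2 * q * (expQueries π ν T a * (klDiv (ν a : Measure ℝ) (ν' a)).toReal) := by
  have hT' : (0 : ℝ) < T := by exact_mod_cast hT
  obtain ⟨F, hF, hF0, hFT, hFω⟩ := exists_measurable_plays_eq T a
  have hint (ρ : Instance K) : ∫ h, F h / T ∂(historyLaw π ρ T) = expPlays π ρ T a / T := by
    rw [integral_div, historyLaw, integral_map (by fun_prop) hF.aestronglyMeasurable]
    simp_rw [hFω]
    rfl
  have hle := klDiv_historyLaw_le π hν hfin T
  have htop := ENNReal.mul_ne_top hfin (ENNReal.ofReal_ne_top (r := expQueries π ν T a))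
  have h := sq_sub_integral_le_klDiv (ne_top_of_le_ne_top htop hle) (hF.div_const (T : ℝ))
    (fun x => div_nonneg (hF0 x) hT'.le) (fun x => (div_le_one hT').2 (hFT x)) hq
    (by rwa [hint, div_le_iff₀ hT']) (by rwa [hint, le_div_iff₀ hT'])
  rw [hint] at h
  have hle' := ENNReal.toReal_mono htop hle
  rw [ENNReal.toReal_mul, ENNReal.toReal_ofReal (expQueries_nonneg π ν T a), mul_comm] at hle'
  exact h.trans (mul_le_mul_of_nonneg_left hle' (by positivity))

/-- With `a` the only optimal arm, the better-than-uniform property bounds the plays of `a` itself.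
-/
lemma optArms_update {ν : Instance K} {a : Fin K} {ρ : ProbabilityMeasure ℝ}
    (hρ : optReward ν < mean ρ) : optArms (Function.update ν a ρ) = {a} := by
  have hne : Nonempty (Fin K) := ⟨a⟩
  have hlt (b : Fin K) (hb : b ≠ a) : mean (Function.update ν a ρ b) < mean ρ := by
    rw [Function.update_of_ne hb]
    exact (le_ciSup (Set.finite_range fun k => mean (ν k)).bddAbove b).trans_lt hρ
  have hopt : optReward (Function.update ν a ρ) = mean ρ := by
    refine le_antisymm (ciSup_le fun b => ?_) ?_
    · rcases eq_or_ne b a with rfl | hb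
      · simp
      · exact (hlt b hb).le
    · have := le_ciSup (Set.finite_range fun k => mean (Function.update ν a ρ k)).bddAbove a
      rwa [Function.update_self] at this
  ext b
  rw [optArms, hopt, Finset.mem_filter_univ, Finset.mem_singleton]
  refine ⟨fun h => by_contra fun hb => (hlt b hb).ne h, ?_⟩
  rintro rfl
  simp

lemma sq_one_sub_expPlays_le {D : Set (ProbabilityMeasure ℝ)} {π : Strategy K}
    (hπ : BetterThanUniform π D) {ν : Instance K} (hν : ∀ k, ν k ∈ D) (a : Fin K) {T : ℕ}
    (hT : 1 ≤ T) (hle : expPlays π ν T a ≤ (T : ℝ) / K) {ρ : ProbabilityMeasure ℝ} (hρD : ρ ∈ D)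
    (hρ : optReward ν < mean ρ) (hfin : klDiv (ν a : Measure ℝ) ρ ≠ ∞) :
    (1 - K * (expPlays π ν T a / T)) ^ 2 ≤
      2 * (K * expQueries π ν T a) * (klDiv (ν a : Measure ℝ) ρ).toReal := by
  have hK : (0 : ℝ) < K := by exact_mod_cast a.pos
  have hne (b : Fin K) (hb : b ≠ a) : ν b = Function.update ν a ρ b :=
    (Function.update_of_ne hb _ _).symm
  have hD (k : Fin K) : Function.update ν a ρ k ∈ D := by
    rcases eq_or_ne k a with rfl | hk
    · simpa using hρD
    · rw [← hne k hk]; exact hν k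
  have hQ := hπ _ hD T hT
  rw [optArms_update hρ, Finset.sum_singleton, Finset.card_singleton, Nat.cast_one] at hQ
  have h := sq_sub_expPlays_le π hne (by simpa using hfin) hT (one_div_pos.2 hK)
    (hle.trans_eq (by ring)) hQ
  rw [Function.update_self] at h
  have h2 := mul_le_mul_of_nonneg_left h (sq_nonneg (K : ℝ))
  calc (1 - K * (expPlays π ν T a / T)) ^ 2
      = K ^ 2 * (1 / K - expPlays π ν T a / T) ^ 2 := by field_simp
    _ ≤ _ := h2
    _ = _ := by field_simp

lemma sq_one_sub_expPlays_le_KinfPlus {D : Set (ProbabilityMeasure ℝ)} {π : Strategy K}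
    (hπ : BetterThanUniform π D) {ν : Instance K} (hν : ∀ k, ν k ∈ D) (a : Fin K) {T : ℕ}
    (hT : 1 ≤ T) (hle : expPlays π ν T a ≤ (T : ℝ) / K)
    (hfin : KinfPlus (ν a) (optReward ν) D ≠ ∞) :
    (1 - K * (expPlays π ν T a / T)) ^ 2 ≤
      2 * (K * expQueries π ν T a) * (KinfPlus (ν a) (optReward ν) D).toReal := by
  set c := 2 * (K * expQueries π ν T a) with hc
  have hc0 : 0 ≤ c := by have := expQueries_nonneg π ν T a; positivity
  set k := KinfPlus (ν a) (optReward ν) D with hk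
  -- The infimum need not be attained: take `ρ` within `ε` of it, then let `ε` tend to zero.
  have hlim : Filter.Tendsto (fun ε : ℝ => c * (k.toReal + ε)) (nhdsWithin 0 (Set.Ioi 0))
      (nhds (c * (k.toReal + 0))) :=
    (Continuous.tendsto (by fun_prop) 0).mono_left nhdsWithin_le_nhds
  rw [add_zero] at hlim
  refine ge_of_tendsto hlim (eventually_nhdsWithin_of_forall fun ε (hε : 0 < ε) => ?_)
  have hlt : k < k + ENNReal.ofReal ε :=
    ENNReal.lt_add_right hfin (ENNReal.ofReal_pos.2 hε).ne'
  obtain ⟨ρ, hρ⟩ := iInf_lt_iff.1 (hk ▸ hlt)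
  obtain ⟨⟨hρD, hρμ⟩, hρk⟩ := iInf_lt_iff.1 hρ
  refine (sq_one_sub_expPlays_le hπ hν a hT hle hρD hρμ hρk.ne_top).trans
    (mul_le_mul_of_nonneg_left ?_ hc0)
  have h := ENNReal.toReal_mono (ENNReal.add_ne_top.2 ⟨hfin, ENNReal.ofReal_ne_top⟩) hρk.le
  rwa [ENNReal.toReal_add hfin ENNReal.ofReal_ne_top, ENNReal.toReal_ofReal hε.le] at h

lemma expPlays_ge {D : Set (ProbabilityMeasure ℝ)} {π : Strategy K}
    (hπ : BetterThanUniform π D) {ν : Instance K} (hν : ∀ k, ν k ∈ D) (a : Fin K) {T : ℕ}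
    (hT : 1 ≤ T) (hfin : KinfPlus (ν a) (optReward ν) D ≠ ∞) :
    (T : ℝ) / K * (1 - √(2 * min (K * expQueries π ν T a) (T : ℝ) *
      (KinfPlus (ν a) (optReward ν) D).toReal)) ≤ expPlays π ν T a := by
  have hK : (0 : ℝ) < K := by exact_mod_cast a.pos
  have hT' : (0 : ℝ) < T := by exact_mod_cast hT
  -- If `a` is played at least `T / K` times the claim is immediate. Otherwise queries being at most
  -- plays gives `K * E[N^q_T(a)] ≤ T`, so the minimum costs nothing.
  rcases le_total (expPlays π ν T a) ((T : ℝ) / K) with hle | hge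
  · have hmin : K * expQueries π ν T a ≤ T := by
      rw [le_div_iff₀' hK] at hle
      exact (mul_le_mul_of_nonneg_left (expQueries_le_expPlays π ν T a) hK.le).trans hle
    rw [min_eq_left hmin]
    have h := Real.le_sqrt_of_sq_le (sq_one_sub_expPlays_le_KinfPlus hπ hν a hT hle hfin)
    calc _ ≤ (T : ℝ) / K * (K * (expPlays π ν T a / T)) :=
          mul_le_mul_of_nonneg_left (by linarith) (by positivity)
      _ = expPlays π ν T a := by field_simp
  · refine le_trans (mul_le_of_le_one_right (by positivity) ?_) hge
    linarith [Real.sqrt_nonneg (2 * min (K * expQueries π ν T a) (T : ℝ) *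
      (KinfPlus (ν a) (optReward ν) D).toReal)]

lemma mul_toReal_le_one_of_ofReal_le {K : ℕ} (hK : 0 < K) {n : ℝ} {k : ℝ≥0∞} (hk : k ≠ ∞)
    (h : ENNReal.ofReal n ≤ 1 / (8 * K * k)) : n * (8 * K * k.toReal) ≤ 1 := by
  -- For `k = 0` the bound in `h` is `1 / 0 = ∞` and constrains nothing, but the left-hand side of
  -- the goal vanishes.
  rcases eq_or_ne k 0 with rfl | hk0
  · simp
  have hd0 : (8 * K * k : ℝ≥0∞) ≠ 0 := by simp [hk0, hK.ne']
  have hd : (8 * K * k : ℝ≥0∞) ≠ ∞ :=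
    ENNReal.mul_ne_top (ENNReal.mul_ne_top (by simp) (by simp)) hk
  rw [ENNReal.le_div_iff_mul_le (.inl hd0) (.inl hd)] at h
  have h2 := ENNReal.toReal_mono ENNReal.one_ne_top h
  simp only [ENNReal.toReal_mul, ENNReal.toReal_ofReal', ENNReal.toReal_natCast,
    ENNReal.toReal_ofNat, ENNReal.toReal_one] at h2
  exact (mul_le_mul_of_nonneg_right (le_max_left n 0) (by positivity)).trans h2

end QueryBandit

theorem proposition1 {K : ℕ} (D : Set (ProbabilityMeasure ℝ))
    (hD : ∀ ν ∈ D, Integrable (fun x : ℝ => x) (ν : Measure ℝ))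
    (π : QueryBandit.Strategy K) (hπ : QueryBandit.BetterThanUniform π D)
    (ν : QueryBandit.Instance K) (hν : ∀ k, ν k ∈ D)
    (a : Fin K) (ha : a ∉ QueryBandit.optArms ν) (T : ℕ) (hT : 1 ≤ T) :
    QueryBandit.expPlays π ν T a ≥
        (if QueryBandit.KinfPlus (ν a) (QueryBandit.optReward ν) D = ∞ then 0
          else (T : ℝ) / K * (1 - √(2 * min (K * QueryBandit.expQueries π ν T a) (T : ℝ) *
            (QueryBandit.KinfPlus (ν a) (QueryBandit.optReward ν) D).toReal))) ∧
      (QueryBandit.KinfPlus (ν a) (QueryBandit.optReward ν) D < ∞ →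
        ENNReal.ofReal (QueryBandit.expQueries π ν T a) ≤
          1 / (8 * K * QueryBandit.KinfPlus (ν a) (QueryBandit.optReward ν) D) →
        QueryBandit.expPlays π ν T a ≥ (T : ℝ) / (2 * K)) := by
  have hK : (0 : ℝ) < K := by exact_mod_cast a.pos
  refine ⟨?_, fun hfin hle => ?_⟩
  · split_ifs with h
    · exact QueryBandit.expPlays_nonneg π ν T a
    · exact QueryBandit.expPlays_ge hπ hν a hT h
  · have h1 := QueryBandit.mul_toReal_le_one_of_ofReal_le a.pos hfin.ne hle
    refine le_trans ?_ (QueryBandit.expPlays_ge hπ hν a hT hfin.ne)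
    have h2 : √(2 * min (K * QueryBandit.expQueries π ν T a) (T : ℝ) *
        (QueryBandit.KinfPlus (ν a) (QueryBandit.optReward ν) D).toReal) ≤ 1 / 2 := by
      -- The constant `8` makes the radicand at most `2 / 8 = (1 / 2) ^ 2`.
      refine Real.sqrt_le_iff.2 ⟨by norm_num, ?_⟩
      have h3 := mul_le_mul_of_nonneg_right
        (min_le_left (K * QueryBandit.expQueries π ν T a) (T : ℝ))
        (ENNReal.toReal_nonneg (a := QueryBandit.KinfPlus (ν a) (QueryBandit.optReward ν) D))
      linarith
    calc (T : ℝ) / (2 * K) = T / K * (1 / 2) := by field_simp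
      _ ≤ _ := mul_le_mul_of_nonneg_left (by linarith) (by positivity)
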